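/- Consider a single-server polling system with $k\ge 2$ queues and setup time $\tau\ge 0$. A job instance $I$ is a finite set of jobs; job $i$ joins a given queue at its release date $r_i\ge 0$ and has processing time $p_i\ge 0$. Jobs are served one at a time and non-preemptively, never before their release; a setup of length $\tau$ is needed before the first job and whenever the server switches from one queue to another. The cost of a schedule is the total completion time $\sum_i C_i$, and $C^*(I)$ is the minimum cost over all (offline) schedules. Let $\gamma\ge 1$, and consider the problem $1\mid r_i,\tau,p_{\max}\le\gamma p_{\min}\mid\sum C_i$: all processing times lie in an interval $[p_{\min},p_{\max}]$, known in advance, with $0\le p_{\min}\le p_{\max}\le\gamma p_{\min}$. A cyclic gated policy is a deterministic online (non-anticipative) policy under which the server visits the queues in the cyclic order $1,\dots,k,1,\dots$; in each visit it serves, without idling and in any order, exactly the jobs that are in the queue at the moment the setup of the visit is completed (later arrivals are left to a later visit), and afterwards it may wait in the queue, but a visit that serves $m$ jobs lasts at most $m\,p_{\max}$ (setup not counted). Let $\Pi_3$ be the class of such policies that do not skip empty queues (the server starts with queue 1 at time $0$ and sets up every queue in turn, empty or not; here $\tau>0$ is understood, since for $\tau=0$ a server facing only empty queues would make infinitely many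 visits at one instant). Let $\Pi_4$ be the class of such policies that skip empty queues: when a visit ends, the server goes to the next non-empty queue in the cyclic order (possibly, last of all, the same queue again, then without a setup), and if all queues are empty it idles in the last queue until the next arrival and then goes to a queue in which a job has just arrived. Then every policy $e\in\Pi_3\cup\Pi_4$ has competitive ratio $\kappa=\max\{\tfrac32\gamma,\,k+1\}$, that is, $C^e(I)\le\kappa\,C^*(I)$ for every instance $I$ of the problem, where $C^e(I)$ is the cost of $e$ on $I$. Moreover, if $\tfrac32\gamma\le k+1$ and $\tau>0$, then for every policy $e\in\Pi_3\cup\Pi_4$ and every $\epsilon>0$ there are $p_{\min}>0$ and an instance $I$ with smallest processing time $p_{\min}$ and largest processing time $p_{\max}=\gamma p_{\min}$ such that $C^*(I)>0$ and $C^e(I)/C^*(I)>\kappa-\epsilon$. -/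

import Mathlib

namespace Polling

noncomputable section

/-- A job: the queue it joins, its release date and its processing time. -/
structure Job (k : ℕ) where
  queue : Fin k
  release : ℝ
  work : ℝ

/-- A finite job instance for a polling system with `k` queues; jobs are numbered in order of
arrival. -/
structure JobInstance (k : ℕ) where
  n : ℕ
  job : Fin n → Job k
  release_nonneg : ∀ i, 0 ≤ (job i).release
  work_nonneg : ∀ i, 0 ≤ (job i).work
  release_mono : Monotone fun i => (job i).release

variable {k : ℕ}

/-- All processing times lie in `[pmin, pmax]`. -/
def JobInstance.WorkIn (I : JobInstance k) (pmin pmax : ℝ) : Prop :=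
  ∀ i, pmin ≤ (I.job i).work ∧ (I.job i).work ≤ pmax

/-- `pmin` and `pmax` are exactly the smallest and the largest processing time. -/
def JobInstance.WorkRange (I : JobInstance k) (pmin pmax : ℝ) : Prop :=
  IsLeast (Set.range fun i => (I.job i).work) pmin ∧
    IsGreatest (Set.range fun i => (I.job i).work) pmax

/-- Every job of `I` released up to time `t` is also in `I'`. -/
def JobInstance.SeenIn (I I' : JobInstance k) (t : ℝ) : Prop :=
  ∀ (i : ℕ) (h : i < I.n), (I.job ⟨i, h⟩).release ≤ t →
    ∃ h' : i < I'.n, I'.job ⟨i, h'⟩ = I.job ⟨i, h⟩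

/-- The same jobs are released up to time `t` in both instances. -/
def JobInstance.AgreeUpTo (I I' : JobInstance k) (t : ℝ) : Prop :=
  I.SeenIn I' t ∧ I'.SeenIn I t

/-! ### The offline optimum -/

/-- Start times `s` form a feasible non-preemptive one-server schedule: no queue is set up at
time `0`, so the first job needs a setup, no job starts before its release, and of any two jobs
one starts after the other is finished, and after a setup if they are in different queues. -/
def Feasible (τ : ℝ) (I : JobInstance k) (s : Fin I.n → ℝ) : Prop :=
  (∀ i, τ ≤ s i ∧ (I.job i).release ≤ s i) ∧
  ∀ i j, i ≠ j →
    s i + (I.job i).work + (if (I.job i).queue = (I.job j).queue then 0 else τ) ≤ s j ∨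
    s j + (I.job j).work + (if (I.job i).queue = (I.job j).queue then 0 else τ) ≤ s i

/-- Total completion time for given start times. -/
def totalCompletion (I : JobInstance k) (s : Fin I.n → ℝ) : ℝ :=
  ∑ i, (s i + (I.job i).work)

/-- The optimal total completion time of the offline problem. -/
def optCost (τ : ℝ) (I : JobInstance k) : ℝ :=
  sInf (totalCompletion I '' {s | Feasible τ I s})

/-! ### Runs of a gated server -/

/-- The log of a server that works in visits `0, 1, 2, …` to queues. For visit number `j`:
`queue j` is the queue visited, `setup j` the time at which the server starts to switch to it,
`depart j` the time at which the visit ends. Job `i` is served in visit `visit i`, and the jobs of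
a visit are served in the order of increasing `pos`. There are `count` visits; values of `queue`,
`setup`, `depart` at other indices are irrelevant. -/
structure Run (I : JobInstance k) where
  count : ℕ∞
  queue : ℕ → Fin k
  setup : ℕ → ℝ
  depart : ℕ → ℝ
  visit : Fin I.n → ℕ
  pos : Fin I.n → ℕ

namespace Run

variable {I : JobInstance k}

/-- The setup time spent for a visit: `τ` for the first visit and whenever the server changes the
queue, nothing if it stays in the queue of the preceding visit. -/
def setupTime (τ : ℝ) (R : Run I) : ℕ → ℝ
  | 0 => τ
  | j + 1 => if R.queue (j + 1) = R.queue j then 0 else τ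

/-- The time at which the queue of visit `j` has been set up. -/
def gate (τ : ℝ) (R : Run I) (j : ℕ) : ℝ :=
  R.setup j + R.setupTime τ j

/-- The jobs served in visit `j`. -/
def batch (R : Run I) (j : ℕ) : Finset (Fin I.n) :=
  Finset.univ.filter fun i => R.visit i = j

/-- The jobs of a visit are served from the gate time on, one after the other without idling. -/
def start (τ : ℝ) (R : Run I) (i : Fin I.n) : ℝ :=
  R.gate τ (R.visit i) +
    ∑ i' ∈ (R.batch (R.visit i)).filter (fun i' => R.pos i' < R.pos i), (I.job i').work

/-- Total completion time of a run. -/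
def cost (τ : ℝ) (R : Run I) : ℝ :=
  totalCompletion I (R.start τ)

/-- The time from which the server is free for visit `j`. -/
def freeTime (R : Run I) : ℕ → ℝ
  | 0 => 0
  | j + 1 => R.depart j

/-- The queue visited before visit `j`; before visit `0` the rotation is about to start with the
first queue. -/
def lastQueue (R : Run I) : ℕ → ℕ
  | 0 => k - 1
  | j + 1 => (R.queue j : ℕ)

/-- At time `t` some job waits in queue `q` that is not served before visit `j`. -/
def Waiting (R : Run I) (j : ℕ) (t : ℝ) (q : Fin k) : Prop :=
  ∃ i, (I.job i).queue = q ∧ (I.job i).release ≤ t ∧ j ≤ R.visit i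

/-- Gated service. The jobs served in a visit are exactly those present in the queue when its
setup is completed: each job is served in the first visit to its queue whose gate time is not
before its release (in particular every job is served). After clearing these jobs the server may
wait in the queue, but a visit that serves `m` jobs lasts at most `m * pmax`. -/
def Gated (τ pmax : ℝ) (R : Run I) : Prop :=
  Function.Injective R.pos ∧
  (∀ i, IsLeast {j : ℕ | (j : ℕ∞) < R.count ∧ R.queue j = (I.job i).queue ∧
    (I.job i).release ≤ R.gate τ j} (R.visit i)) ∧
  ∀ j : ℕ, (j : ℕ∞) < R.count →
    R.gate τ j + ∑ i ∈ R.batch j, (I.job i).work ≤ R.depart j ∧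
    R.depart j ≤ R.gate τ j + (R.batch j).card * pmax

/-- Cyclic routing without skipping: the server starts at time `0` with the first queue, visits
the queues cyclically for ever, and starts the next setup as soon as a visit ends. -/
def CyclicNoSkip (R : Run I) : Prop :=
  R.count = ⊤ ∧ ∀ j, (R.queue j : ℕ) = j % k ∧ R.setup j = R.freeTime j

/-- The number of queues passed over when moving cyclically from queue `c` forward to queue `q`;
queue `c` itself comes last. -/
def ahead (c : ℕ) (q : Fin k) : ℕ :=
  (q + (k - (c + 1))) % k

/-- Choice of visit `j` with skipping of empty queues: the server switches as soon as it is free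
and some queue is not empty. If it need not idle for that, it goes to the first non-empty queue in
the cyclic order; if it had to idle, it goes to a queue in which a job has just arrived. -/
def SkipStep (R : Run I) (j : ℕ) : Prop :=
  IsLeast {t : ℝ | R.freeTime j ≤ t ∧ ∃ q, R.Waiting j t q} (R.setup j) ∧
  R.Waiting j (R.setup j) (R.queue j) ∧
  (R.setup j = R.freeTime j → ∀ q, R.Waiting j (R.setup j) q →
    ahead (R.lastQueue j) (R.queue j) ≤ ahead (R.lastQueue j) q)

/-- Cyclic routing with skipping of empty queues. It is left open whether the server sets up the
first queue at time `0` also when that queue is empty at that time. -/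
def CyclicSkip (R : Run I) : Prop :=
  ∀ j : ℕ, (j : ℕ∞) < R.count →
    R.SkipStep j ∨ (j = 0 ∧ (R.queue 0 : ℕ) = 0 ∧ R.setup 0 = 0)

/-- Everything that the server does in `R` up to time `t` it does also in `R'`. -/
def SameUpTo {I' : JobInstance k} (τ : ℝ) (R : Run I) (R' : Run I') (t : ℝ) : Prop :=
  (∀ j : ℕ, (j : ℕ∞) < R.count → R.setup j ≤ t →
    (j : ℕ∞) < R'.count ∧ R'.queue j = R.queue j ∧ R'.setup j = R.setup j ∧
    (R.depart j ≤ t → R'.depart j = R.depart j)) ∧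
  ∀ (i : ℕ) (h : i < I.n), R.start τ ⟨i, h⟩ ≤ t →
    ∃ h' : i < I'.n, R'.start τ ⟨i, h'⟩ = R.start τ ⟨i, h⟩

end Run

/-! ### Policies -/

/-- A deterministic policy: given the a priori bounds `pmin`, `pmax` for the processing times, it
produces a run on every job instance. -/
def Policy (k : ℕ) : Type :=
  ℝ → ℝ → (I : JobInstance k) → Run I

/-- The inputs of the problem with workload variation at most `γ`. -/
def Admissible (γ pmin pmax : ℝ) (I : JobInstance k) : Prop :=
  0 ≤ pmin ∧ pmin ≤ pmax ∧ pmax ≤ γ * pmin ∧ I.WorkIn pmin pmax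

/-- A policy is online (non-anticipative): what it does up to a time `t` depends only on the jobs
released up to time `t`. -/
def Policy.Online (τ γ : ℝ) (e : Policy k) : Prop :=
  ∀ (pmin pmax : ℝ) (I I' : JobInstance k), Admissible γ pmin pmax I → Admissible γ pmin pmax I' →
    ∀ t, I.AgreeUpTo I' t → (e pmin pmax I).SameUpTo τ (e pmin pmax I') t

/-- Online cyclic gated policies without skipping empty queues. -/
def gatedNoSkip (k : ℕ) (τ γ : ℝ) : Set (Policy k) :=
  {e | e.Online τ γ ∧ ∀ (pmin pmax : ℝ) (I : JobInstance k), Admissible γ pmin pmax I →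
    (e pmin pmax I).Gated τ pmax ∧ (e pmin pmax I).CyclicNoSkip}

/-- Online cyclic gated policies with skipping empty queues. -/
def gatedSkip (k : ℕ) (τ γ : ℝ) : Set (Policy k) :=
  {e | e.Online τ γ ∧ ∀ (pmin pmax : ℝ) (I : JobInstance k), Admissible γ pmin pmax I →
    (e pmin pmax I).Gated τ pmax ∧ (e pmin pmax I).CyclicSkip}

/-- `e` has competitive ratio (at most) `ρ`. -/
def Policy.HasCompetitiveRatio (τ γ : ℝ) (e : Policy k) (ρ : ℝ) : Prop :=
  ∀ (pmin pmax : ℝ) (I : JobInstance k), Admissible γ pmin pmax I →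
    (e pmin pmax I).cost τ ≤ ρ * optCost τ I

end

end Polling

namespace Polling

open Finset

variable {k : ℕ}

/-! ### Rearrangements -/

/-! Upper bound: compare the `m`-th job served by the policy with the `m`-th job started by an
arbitrary schedule, counting from `0`; let `r` be the `m`-th release date. By pigeonhole some job
released by `r` is served no earlier than the policy's `m`-th. From its release on, the server
spends at most `k` setups before the gate concerned (`Run.Gated.gate_le`), and visits cost at most
`pmax` per job. So the `m`-th completion is at most `r + k * τ + (m + 1) * pmax`
(`Run.Gated.exists_perm`). In any schedule the `m`-th completion `E` satisfies `E ≥ r` and `E ≥ τ +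
(m + 1) * pmin` (`Feasible.exists_perm`). Hence the ratio holds term by term (`Run.Gated.cost_le`).

Lower bound: one instance (`burst`) defeats all policies. Many tiny jobs reach the first queue just
after its gate at time `τ`; a job in every other queue makes the server go round, so the burst waits
until `(k + 1) * τ`, while the optimum serves it shortly after `τ`. -/

lemma exists_ge_perm_le {n : ℕ} (σ : Equiv.Perm (Fin n)) (m : Fin n) :
    ∃ m', m ≤ m' ∧ σ m' ≤ m := by
  by_contra! h
  -- Otherwise `σ` would map `Ici m` injectively into the smaller set `Ioi m`.
  have hc : (Finset.Ici m).card ≤ (Finset.Ioi m).card :=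
    Finset.card_le_card_of_injOn σ (fun x hx => by
      have := h x (by simpa using hx)
      simpa using this) σ.injective.injOn
  rw [Fin.card_Ici, Fin.card_Ioi] at hc
  have := m.isLt
  omega

lemma exists_le_perm_ge {n : ℕ} (σ : Equiv.Perm (Fin n)) (m : Fin n) :
    ∃ m', m' ≤ m ∧ m ≤ σ m' := by
  obtain ⟨x, hx, hx'⟩ := exists_ge_perm_le σ⁻¹ m
  exact ⟨σ⁻¹ x, hx', by simpa using hx⟩

/-! ### The offline optimum -/

/-- Slots of length `B`, which exceeds any release date plus work plus a setup, leave room for every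
job. Feasibility matters because `sInf ∅ = 0` would spoil lower bounds on `optCost`. -/
lemma exists_feasible {τ : ℝ} (hτ : 0 ≤ τ) (I : JobInstance k) : ∃ s, Feasible τ I s := by
  set B : ℝ := ∑ i, ((I.job i).release + (I.job i).work) + τ with hB
  have hle : ∀ i, (I.job i).release + (I.job i).work ≤ B - τ := fun i => by
    have := Finset.single_le_sum (f := fun i => (I.job i).release + (I.job i).work)
      (fun j _ => add_nonneg (I.release_nonneg j) (I.work_nonneg j)) (Finset.mem_univ i)
    linarith
  have hB0 : τ ≤ B := by
    have : 0 ≤ ∑ i, ((I.job i).release + (I.job i).work) :=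
      Finset.sum_nonneg fun j _ => add_nonneg (I.release_nonneg j) (I.work_nonneg j)
    linarith
  have step : ∀ i j : Fin I.n, i < j →
      ((i : ℝ) + 1) * B + (I.job i).work + (if (I.job i).queue = (I.job j).queue then 0 else τ)
        ≤ ((j : ℝ) + 1) * B := fun i j hij => by
    have h1 : ((i : ℝ) + 1) ≤ j := by exact_mod_cast hij
    have h2 := mul_le_mul_of_nonneg_right h1 (hτ.trans hB0)
    have h3 := hle i
    have h4 := I.release_nonneg i
    split_ifs <;> nlinarith
  refine ⟨fun i => ((i : ℝ) + 1) * B, fun i => ?_, fun i j hij => ?_⟩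
  · have h1 : 0 ≤ (i : ℝ) * B := mul_nonneg (Nat.cast_nonneg _) (hτ.trans hB0)
    have h3 := hle i
    have h4 := I.work_nonneg i
    constructor <;> nlinarith
  · rcases lt_or_gt_of_ne hij with h | h
    · exact Or.inl (step i j h)
    · right
      have := step j i h
      simpa only [eq_comm] using this

lemma le_optCost {τ c : ℝ} (hτ : 0 ≤ τ) {I : JobInstance k}
    (h : ∀ s, Feasible τ I s → c ≤ totalCompletion I s) : c ≤ optCost τ I := by
  obtain ⟨s, hs⟩ := exists_feasible hτ I
  refine le_csInf ⟨_, s, hs, rfl⟩ ?_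
  rintro _ ⟨s, hs, rfl⟩
  exact h s hs

lemma card_mul_le_totalCompletion {τ : ℝ} {I : JobInstance k} {s : Fin I.n → ℝ}
    (hs : Feasible τ I s) : I.n * τ ≤ totalCompletion I s := by
  have : ∑ _i : Fin I.n, τ ≤ totalCompletion I s :=
    Finset.sum_le_sum fun i _ => by linarith [(hs.1 i).1, I.work_nonneg i]
  simpa using this

lemma optCost_le {τ : ℝ} {I : JobInstance k} {s : Fin I.n → ℝ}
    (hs : Feasible τ I s) : optCost τ I ≤ totalCompletion I s := by
  refine csInf_le ⟨I.n * τ, ?_⟩ ⟨s, hs, rfl⟩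
  rintro _ ⟨s, hs, rfl⟩
  exact card_mul_le_totalCompletion hs

/-- In any schedule the `m`-th job started (counted from `0`) starts neither before the `m`-th
release date nor before the setup and `m` shortest jobs fit. -/
lemma Feasible.exists_perm {τ p : ℝ} {I : JobInstance k} {s : Fin I.n → ℝ}
    (hs : Feasible τ I s) (hw : ∀ i, p ≤ (I.job i).work) (hτ : 0 ≤ τ) :
    ∃ σ : Equiv.Perm (Fin I.n), ∀ m : Fin I.n, τ + ((m : ℕ) : ℝ) * p ≤ s (σ m) ∧
      (I.job m).release ≤ s (σ m) := by
  set σ := Tuple.sort s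
  have hmono : Monotone (s ∘ σ) := Tuple.monotone_sort s
  refine ⟨σ, fun m => ⟨?_, ?_⟩⟩
  · obtain ⟨m, hm⟩ := m
    induction m with
    | zero => simpa using (hs.1 (σ ⟨0, hm⟩)).1
    | succ m ih =>
      have h0 := ih (by omega)
      have hlt : (⟨m, by omega⟩ : Fin I.n) < ⟨m + 1, hm⟩ := by simp
      have hle : s (σ ⟨m, by omega⟩) ≤ s (σ ⟨m + 1, hm⟩) := hmono hlt.le
      have hne : σ ⟨m, by omega⟩ ≠ σ ⟨m + 1, hm⟩ := fun h => hlt.ne (σ.injective h)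
      have hset : (0 : ℝ) ≤ if (I.job (σ ⟨m, by omega⟩)).queue =
          (I.job (σ ⟨m + 1, hm⟩)).queue then 0 else τ := by split_ifs <;> simp [hτ]
      have hw1 := hw (σ ⟨m, by omega⟩)
      have hw2 := hw (σ ⟨m + 1, hm⟩)
      push_cast at h0 ⊢
      rcases hs.2 _ _ hne with h | h <;> linarith
  -- One of the first `m + 1` jobs started has index at least `m`, so it is released no earlier than
  -- job `m`.
  · obtain ⟨m', h1, h2⟩ := exists_le_perm_ge σ m
    calc (I.job m).release ≤ (I.job (σ m')).release := I.release_mono h2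
      _ ≤ s (σ m') := (hs.1 _).2
      _ ≤ s (σ m) := hmono h1

/-! ### Cyclic distance -/

namespace Run

lemma ahead_eq {c : ℕ} (hc : c < k) (q : Fin k) :
    ahead c q = if c < q then (q : ℕ) - c - 1 else q + k - c - 1 := by
  have hq := q.isLt
  unfold ahead
  split_ifs with h
  · rw [Nat.mod_eq_sub_mod (by omega), Nat.mod_eq_of_lt (by omega)]
    omega
  · rw [Nat.mod_eq_of_lt (by omega)]
    omega

lemma ahead_lt {c : ℕ} (hc : c < k) (q : Fin k) : ahead c q < k := by
  have hq := q.isLt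
  rw [ahead_eq hc]
  split_ifs <;> omega

/-- A move from `c` that neither reaches nor passes over `q` ends in one of the queues strictly
between, and this queue is no longer ahead. -/
lemma ahead_add_one_le {c : ℕ} (hc : c < k) {q q' : Fin k} (hne : q' ≠ q)
    (h : ahead c q' ≤ ahead c q) : ahead q' q + 1 ≤ ahead c q := by
  have hq := q.isLt
  have hq' := q'.isLt
  have hne' : (q' : ℕ) ≠ q := fun h => hne (Fin.ext h)
  rw [ahead_eq hc, ahead_eq hc] at h
  rw [ahead_eq hq', ahead_eq hc]
  split_ifs at h ⊢ <;> omega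

/-! ### Gate times -/

variable {I : JobInstance k} {R : Run I} {τ pmax : ℝ}

lemma setupTime_le (hτ : 0 ≤ τ) (j : ℕ) : R.setupTime τ j ≤ τ := by
  cases j with
  | zero => exact le_rfl
  | succ j => simp only [setupTime]; split_ifs <;> simp [hτ]

lemma setupTime_nonneg (hτ : 0 ≤ τ) (j : ℕ) : 0 ≤ R.setupTime τ j := by
  cases j with
  | zero => exact hτ
  | succ j => simp only [setupTime]; split_ifs <;> simp [hτ]

lemma Gated.visit_lt (h : R.Gated τ pmax) (i : Fin I.n) : (R.visit i : ℕ∞) < R.count :=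
  (h.2.1 i).1.1

/-- Otherwise that earlier visit would already have served `a`. -/
lemma Gated.gate_lt_release (h : R.Gated τ pmax) {a : Fin I.n} {j : ℕ} (hj : j < R.visit a)
    (hq : R.queue j = (I.job a).queue) : R.gate τ j < (I.job a).release := by
  by_contra! hr
  have hjc : (j : ℕ∞) < R.count := lt_trans (by exact_mod_cast hj) (h.visit_lt a)
  exact absurd ((h.2.1 a).2 ⟨hjc, hq, hr⟩) (by omega)

lemma Gated.gate_le_depart (h : R.Gated τ pmax) {j : ℕ} (hj : (j : ℕ∞) < R.count) :
    R.gate τ j ≤ R.depart j := by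
  have := (h.2.2 j hj).1
  have h0 : 0 ≤ ∑ i ∈ R.batch j, (I.job i).work := Finset.sum_nonneg fun i _ => I.work_nonneg i
  linarith

/-- The jobs served before visit `j`. -/
def served (R : Run I) (j : ℕ) : Finset (Fin I.n) :=
  Finset.univ.filter fun i => R.visit i < j

lemma card_served_succ (R : Run I) (j : ℕ) :
    (R.served (j + 1)).card = (R.served j).card + (R.batch j).card := by
  rw [← Finset.card_union_of_disjoint]
  · congr 1
    ext i
    simp only [served, batch, Finset.mem_union, Finset.mem_filter, Finset.mem_univ, true_and]
    omega
  · refine Finset.disjoint_left.2 fun i hi hi' => ?_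
    simp only [served, batch, Finset.mem_filter, Finset.mem_univ, true_and] at hi hi'
    omega

/-- Before job `a` is served, the server, once free, moves on without passing over the queue of
`a`, unless `a` has not yet been released. -/
def Heads (R : Run I) (a : Fin I.n) : Prop :=
  ∀ j ≤ R.visit a, R.setup j ≤ (I.job a).release ∨
    (R.setup j = R.freeTime j ∧
      ahead (R.lastQueue j) (R.queue j) ≤ ahead (R.lastQueue j) (I.job a).queue)

lemma CyclicNoSkip.heads (h : R.CyclicNoSkip) (a : Fin I.n) : R.Heads a := by
  intro j _
  refine Or.inr ⟨(h.2 j).2, ?_⟩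
  have hk : 0 < k := (R.queue j).pos
  have h0 : ahead (R.lastQueue j) (R.queue j) = 0 := by
    unfold ahead
    rw [(h.2 j).1]
    cases j with
    | zero => simp [lastQueue, Nat.sub_add_cancel hk]
    | succ j =>
      have := Nat.mod_lt j hk
      simp only [lastQueue, (h.2 j).1, Nat.mod_add_mod]
      have h2 : j + 1 + (k - (j % k + 1)) = k * (j / k + 1) := by
        have := Nat.div_add_mod j k
        rw [mul_add]
        omega
      rw [h2, Nat.mul_mod_right]
  rw [h0]
  exact Nat.zero_le _

/-- While `a` is released and unserved its queue is non-empty, so the server neither idles nor skips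
that queue. The optional initial setup of an empty queue happens at time `0`, before any release. -/
lemma CyclicSkip.heads (h : R.CyclicSkip) (hg : R.Gated τ pmax) (a : Fin I.n) : R.Heads a := by
  intro j hj
  have hjc : (j : ℕ∞) < R.count := lt_of_le_of_lt (by exact_mod_cast hj) (hg.visit_lt a)
  rcases h j hjc with ⟨hleast, -, hmin⟩ | ⟨rfl, -, h0⟩
  · by_cases hr : R.setup j ≤ (I.job a).release
    · exact Or.inl hr
    · push Not at hr
      have h1 : R.setup j ≤ max (R.freeTime j) (I.job a).release :=
        hleast.2 ⟨le_max_left _ _, (I.job a).queue, a, rfl, le_max_right _ _, hj⟩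
      have h2 : R.setup j = R.freeTime j := by
        refine le_antisymm ?_ hleast.1.1
        rcases le_max_iff.1 h1 with h | h
        · exact h
        · exact absurd h (not_le.2 hr)
      exact Or.inr ⟨h2, hmin h2 _ ⟨a, rfl, hr.le, hj⟩⟩
  · exact Or.inl ((h0.le.trans (I.release_nonneg a)))

/-- The second bound is the invariant: `k - 1 - ahead` pays for the setups made since the release of
`a`, as each switch lowers `ahead` by at least one. The visit that serves `a` may add one more
setup, giving `k`. -/
lemma Gated.gate_le (hg : R.Gated τ pmax) (hτ : 0 ≤ τ) (hP : 0 ≤ pmax) {a : Fin I.n}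
    (ha : R.Heads a) {j : ℕ} (hj : j ≤ R.visit a) :
    R.gate τ j ≤ (I.job a).release + k * τ + pmax * (R.served j).card ∧
    (j < R.visit a → R.gate τ j ≤ (I.job a).release +
      ((k : ℝ) - 1 - ahead (R.queue j) (I.job a).queue) * τ + pmax * (R.served j).card) := by
  have hk1 : (1 : ℝ) ≤ k := by exact_mod_cast (R.queue 0).pos
  have hcard : ∀ j, 0 ≤ pmax * ((R.served j).card : ℝ) := fun j =>
    mul_nonneg hP (Nat.cast_nonneg _)
  have hr0 := I.release_nonneg a
  induction j with
  | zero =>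
    have hs : R.setup 0 ≤ (I.job a).release := by
      rcases ha 0 hj with h | ⟨h, -⟩
      · exact h
      · exact h ▸ hr0
    have hgate : R.gate τ 0 ≤ (I.job a).release + τ := by
      simp only [gate, setupTime]; linarith
    refine ⟨by nlinarith [hcard 0], fun hlt => ?_⟩
    by_cases hq : R.queue 0 = (I.job a).queue
    · have h1 := hg.gate_lt_release hlt hq
      have h2 : (ahead (R.queue 0) (I.job a).queue : ℝ) + 1 ≤ k := by
        exact_mod_cast ahead_lt (R.queue 0).isLt _
      nlinarith [hcard 0]
    · have h2 : (ahead (R.queue 0) (I.job a).queue : ℝ) + 1 + 1 ≤ k := by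
        -- Every queue is within reach from the queue of `a` itself, where `ahead` takes its maximum
        -- `k - 1`; any other queue therefore has `ahead` at most `k - 2`.
        have h3 := ahead_add_one_le (q := (I.job a).queue) (q' := R.queue 0)
          (c := (I.job a).queue) (Fin.isLt _) hq (by
            have h4 := ahead_lt (k := k) (c := (I.job a).queue) (Fin.isLt _) (R.queue 0)
            have h5 : ahead (I.job a).queue (I.job a).queue = k - 1 := by
              have := (I.job a).queue.isLt
              rw [ahead_eq (Fin.isLt _)]
              simp only [lt_irrefl, if_false]
              omega
            omega)
        have h4 := ahead_lt (k := k) (c := (I.job a).queue) (Fin.isLt _) (I.job a).queue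
        exact_mod_cast (by omega : ahead (R.queue 0) (I.job a).queue + 1 + 1 ≤ k)
      nlinarith [hcard 0]
  | succ j ih =>
    have hjlt : j < R.visit a := by omega
    have hjc : (j : ℕ∞) < R.count := lt_trans (by exact_mod_cast hjlt) (hg.visit_lt a)
    have ih' := (ih hjlt.le).2 hjlt
    have hst := setupTime_le (R := R) hτ (j + 1)
    have hdep := (hg.2.2 j hjc).2
    have hc : ((R.served (j + 1)).card : ℝ) = (R.served j).card + (R.batch j).card := by
      exact_mod_cast R.card_served_succ j
    have hA : (0 : ℝ) ≤ ahead (R.queue j) (I.job a).queue := Nat.cast_nonneg _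
    have hcj := hcard (j + 1)
    have hlt1 : (ahead (R.queue (j + 1)) (I.job a).queue : ℝ) + 1 ≤ k := by
      exact_mod_cast ahead_lt (R.queue (j + 1)).isLt _
    have hstep := ha (j + 1) hj
    simp only [freeTime, lastQueue] at hstep
    refine ⟨?_, fun hlt => ?_⟩
    · rcases hstep with h | ⟨h, -⟩
      · simp only [gate] at *
        nlinarith
      · simp only [gate] at *
        rw [hc, h]
        nlinarith
    -- A visit to the queue of `a` that does not serve `a` has its gate before the release, so no
    -- setup needs to be paid for.
    · by_cases hq : R.queue (j + 1) = (I.job a).queue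
      · have h1 := hg.gate_lt_release hlt hq
        nlinarith
      · rcases hstep with h | ⟨h, hah⟩
        · have h2 : (ahead (R.queue (j + 1)) (I.job a).queue : ℝ) + 1 + 1 ≤ k := by
            have hq' : (R.queue (j + 1) : ℕ) ≠ (I.job a).queue := fun h => hq (Fin.ext h)
            have h3 : ahead (R.queue (j + 1)) (I.job a).queue + 1 + 1 ≤ k := by
              have := (I.job a).queue.isLt
              have := (R.queue (j + 1)).isLt
              rw [ahead_eq (Fin.isLt _)]
              split_ifs <;> omega
            exact_mod_cast h3
          simp only [gate] at *
          nlinarith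
        · have h2 : (ahead (R.queue (j + 1)) (I.job a).queue : ℝ) + 1 ≤
              ahead (R.queue j) (I.job a).queue := by
            exact_mod_cast ahead_add_one_le (R.queue j).isLt hq hah
          simp only [gate] at *
          rw [hc, h]
          nlinarith

/-- Order the jobs as served. A job of index at most `m`, served no earlier than `σ m`, bounds the
gate of the visit of `σ m`; the jobs served before that visit, those before `σ m` within it, and `σ
m` itself number at most `m + 1`. -/
lemma Gated.exists_perm (hg : R.Gated τ pmax) (hτ : 0 ≤ τ) (hP : 0 ≤ pmax)
    (hw : ∀ i, (I.job i).work ≤ pmax) (ha : ∀ a, R.Heads a) :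
    ∃ σ : Equiv.Perm (Fin I.n), ∀ m, R.start τ (σ m) + (I.job (σ m)).work ≤
      (I.job m).release + k * τ + pmax * ((m : ℕ) + 1) := by
  set key : Fin I.n → ℕ ×ₗ ℕ := fun i => toLex (R.visit i, R.pos i) with hkey
  set σ := Tuple.sort key
  have hmono : Monotone (key ∘ σ) := Tuple.monotone_sort key
  refine ⟨σ, fun m => ?_⟩
  obtain ⟨m', h1, h2⟩ := exists_ge_perm_le σ m
  have hvis : R.visit (σ m) ≤ R.visit (σ m') := by
    have := hmono h1
    simp only [Function.comp, hkey, Prod.Lex.toLex_le_toLex] at this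
    omega
  have hgate := (hg.gate_le hτ hP (ha (σ m')) hvis).1
  have hrel : (I.job (σ m')).release ≤ (I.job m).release := I.release_mono h2
  set v := R.visit (σ m)
  set S := (R.batch v).filter (fun i' => R.pos i' < R.pos (σ m))
  have hS : ∑ i' ∈ S, (I.job i').work ≤ pmax * S.card := by
    have := Finset.sum_le_card_nsmul S (fun i => (I.job i).work) pmax fun i _ => hw i
    rw [nsmul_eq_mul] at this
    linarith
  have hcard : (R.served v).card + S.card ≤ m := by
    rw [← Finset.card_union_of_disjoint]
    · have hc := Finset.card_le_card_of_injOn (s := R.served v ∪ S) (t := Finset.Iio m) σ.symm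
        (fun x hx => by
          have hlt : key x < key (σ m) := by
            simp only [hkey, Prod.Lex.toLex_lt_toLex]
            simp only [S, served, batch, Finset.coe_union, Finset.coe_filter, Finset.mem_filter,
              Finset.mem_univ, true_and, Set.mem_union, Set.mem_ofPred_eq] at hx
            exact hx
          have : σ.symm x < m := by
            by_contra! hle
            have := hmono hle
            simp only [Function.comp, Equiv.apply_symm_apply] at this
            exact absurd this (not_le.2 hlt)
          simpa using this) σ.symm.injective.injOn
      simpa using hc
    · refine Finset.disjoint_left.2 fun i hi hi' => ?_
      simp only [S, served, batch, Finset.mem_filter, Finset.mem_univ, true_and] at hi hi'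
      omega
  have hcard' : ((R.served v).card : ℝ) + S.card ≤ (m : ℕ) := by exact_mod_cast hcard
  have := hw (σ m)
  have hst : R.start τ (σ m) = R.gate τ v + ∑ i' ∈ S, (I.job i').work := rfl
  rw [hst]
  nlinarith [mul_le_mul_of_nonneg_left hcard' hP]

lemma Gated.cost_le (hg : R.Gated τ pmax) (hτ : 0 ≤ τ) {γ pmin : ℝ} (hk : 2 ≤ k) (hγ : 1 ≤ γ)
    (hadm : Admissible γ pmin pmax I) (ha : ∀ a, R.Heads a) :
    R.cost τ ≤ max (3 / 2 * γ) ((k : ℝ) + 1) * optCost τ I := by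
  obtain ⟨hp0, hpp, hpγ, hw⟩ := hadm
  set κ := max (3 / 2 * γ) ((k : ℝ) + 1)
  have hk2 : (2 : ℝ) ≤ k := by exact_mod_cast hk
  have hκ1 : (k : ℝ) + 1 ≤ κ := le_max_right _ _
  -- For `γ ≤ 2` use `k + 1 ≥ 3`; for larger `γ`, `3 / 2 * γ` exceeds `1 + γ`.
  have hκ2 : 1 + γ ≤ κ := by
    have : 3 / 2 * γ ≤ κ := le_max_left _ _
    by_cases h : γ ≤ 2 <;> linarith
  have hκ0 : 0 < κ := by linarith
  rw [mul_comm, ← div_le_iff₀ hκ0]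
  refine le_optCost hτ fun s hs => ?_
  rw [div_le_iff₀ hκ0]
  obtain ⟨σ, hσ⟩ := hg.exists_perm hτ (hp0.trans hpp) (fun i => (hw i).2) ha
  obtain ⟨ρ, hρ⟩ := hs.exists_perm (fun i => (hw i).1) hτ
  have e1 : R.cost τ = ∑ m, (R.start τ (σ m) + (I.job (σ m)).work) :=
    (Equiv.sum_comp σ fun i => R.start τ i + (I.job i).work).symm
  have e2 : totalCompletion I s = ∑ m, (s (ρ m) + (I.job (ρ m)).work) :=
    (Equiv.sum_comp ρ fun i => s i + (I.job i).work).symm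
  rw [e1, e2, Finset.sum_mul]
  refine Finset.sum_le_sum fun m _ => (hσ m).trans ?_
  obtain ⟨h1, h2⟩ := hρ m
  have hwm := (hw (ρ m)).1
  set E := s (ρ m) + (I.job (ρ m)).work
  have hm0 : (0 : ℝ) ≤ (m : ℕ) := Nat.cast_nonneg _
  have hE1 : (I.job m).release ≤ E := by
    have := I.work_nonneg (ρ m)
    linarith
  have hE2 : τ + ((m : ℕ) + 1) * pmin ≤ E := by simp only [E]; linarith
  have hE3 : τ ≤ E := by nlinarith
  have h3 : pmax * ((m : ℕ) + 1) ≤ γ * (E - τ) := by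
    calc pmax * (((m : ℕ) : ℝ) + 1) ≤ γ * pmin * ((m : ℕ) + 1) :=
          mul_le_mul_of_nonneg_right hpγ (by linarith)
      _ = γ * (((m : ℕ) + 1) * pmin) := by ring
      _ ≤ γ * (E - τ) := mul_le_mul_of_nonneg_left (by linarith) (by linarith)
  -- It remains to see `E + k * τ + γ * (E - τ) ≤ κ * E`. As `κ ≥ 1 + γ`, the worst case is `E = τ`,
  -- which is `k + 1 ≤ κ`.
  have h4 : (κ - 1 - γ) * τ ≤ (κ - 1 - γ) * E := mul_le_mul_of_nonneg_left hE3 (by linarith)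
  have h5 : ((k : ℝ) + 1) * τ ≤ κ * τ := mul_le_mul_of_nonneg_right hκ1 hτ
  nlinarith

end Run

/-! ### A burst that has just missed the server -/

section Burst

variable (k) (τ γ p : ℝ) (M : ℕ)

/-- One job in every queue at time `0`, and `M` more jobs in the first queue at time `τ + τ / M`.
The very first job has processing time `γ * p`, the others have `p`. -/
noncomputable def burst (hk : 0 < k) (hτ : 0 ≤ τ) (hγ : 0 ≤ γ) (hp : 0 ≤ p) : JobInstance k where
  n := k + M
  job i :=
    { queue := if h : (i : ℕ) < k then ⟨i, h⟩ else ⟨0, hk⟩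
      release := if (i : ℕ) < k then 0 else τ + τ / M
      work := if (i : ℕ) = 0 then γ * p else p }
  release_nonneg i := by
    dsimp only
    split_ifs
    · exact le_rfl
    · positivity
  work_nonneg i := by
    dsimp only
    split_ifs
    · positivity
    · exact hp
  release_mono i j hij := by
    have hij' : (i : ℕ) ≤ j := hij
    dsimp only
    split_ifs
    · exact le_rfl
    · positivity
    · omega
    · exact le_rfl

variable {k τ γ p M} {hk : 0 < k} {hτ : 0 ≤ τ} {hγ : 0 ≤ γ} {hp : 0 ≤ p}

lemma burst_work_le (hγ1 : 1 ≤ γ) (i) :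
    p ≤ ((burst k τ γ p M hk hτ hγ hp).job i).work ∧
      ((burst k τ γ p M hk hτ hγ hp).job i).work ≤ γ * p := by
  have : p ≤ γ * p := le_mul_of_one_le_left hp hγ1
  simp only [burst]
  split_ifs <;> simp [this]

lemma burst_workRange (hk2 : 2 ≤ k) (hγ1 : 1 ≤ γ) :
    (burst k τ γ p M hk hτ hγ hp).WorkRange p (γ * p) := by
  refine ⟨⟨⟨⟨1, ?_⟩, ?_⟩, ?_⟩, ⟨⟨⟨0, ?_⟩, ?_⟩, ?_⟩⟩
  · simp only [burst]; omega
  · simp [burst]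
  · rintro _ ⟨i, rfl⟩
    exact (burst_work_le hγ1 i).1
  · simp only [burst]; omega
  · simp [burst]
  · rintro _ ⟨i, rfl⟩
    exact (burst_work_le hγ1 i).2

lemma totalCompletion_burst (s : Fin (k + M) → ℝ) :
    totalCompletion (burst k τ γ p M hk hτ hγ hp) s =
      ∑ i : Fin k, (s (Fin.castAdd M i) +
        ((burst k τ γ p M hk hτ hγ hp).job (Fin.castAdd M i)).work) +
      ∑ i : Fin M, (s (Fin.natAdd k i) +
        ((burst k τ γ p M hk hτ hγ hp).job (Fin.natAdd k i)).work) :=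
  Fin.sum_univ_add (fun i : Fin (k + M) =>
    s i + ((burst k τ γ p M hk hτ hγ hp).job i).work)

/-- Serving the burst first. -/
lemma optCost_burst_le (hγ1 : 1 ≤ γ) (hM : 0 < M) (hpM : γ * p = τ / M ^ 2) :
    optCost τ (burst k τ γ p M hk hτ hγ hp) ≤ τ * (M + 2 + k * (4 + 2 * k)) := by
  set P := γ * p with hP
  have hP0 : 0 ≤ P := by positivity
  set I := burst k τ γ p M hk hτ hγ hp
  have hM1 : (1 : ℝ) ≤ M := by exact_mod_cast hM
  set δ := τ / (M : ℝ) with hδ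
  have hδ0 : 0 ≤ δ := by positivity
  have hMδ : M * δ = τ := by rw [hδ]; field_simp
  have hMP : M * P = δ := by rw [hpM, hδ]; field_simp
  have hδτ : δ ≤ τ := by nlinarith
  have hPτ : P ≤ τ := by nlinarith
  -- The burst starts on arrival in slots of length `P`; then the initial jobs follow, each slot
  -- including a full setup.
  set s : Fin (k + M) → ℝ := fun i =>
    if (i : ℕ) < k then τ + δ + M * P + τ + i * (P + τ) else τ + δ + ((i : ℝ) - k) * P with hs
  have hlt : ∀ i : Fin (k + M), (i : ℕ) < k → s i = τ + δ + M * P + τ + i * (P + τ) :=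
    fun i hi => if_pos hi
  have hge : ∀ i : Fin (k + M), ¬ (i : ℕ) < k → s i = τ + δ + ((i : ℝ) - k) * P :=
    fun i hi => if_neg hi
  have hw : ∀ i, (I.job i).work ≤ P := fun i => (burst_work_le hγ1 i).2
  have hrel : ∀ i, (I.job i).release = if (i : ℕ) < k then 0 else τ + δ := fun i => rfl
  have hqueue : ∀ i : Fin I.n, (I.job i).queue = if h : (i : ℕ) < k then ⟨i, h⟩ else ⟨0, hk⟩ :=
    fun i => rfl
  have hset : ∀ i j : Fin I.n,
      (if (I.job i).queue = (I.job j).queue then 0 else τ) ≤ τ := fun i j => by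
    split_ifs <;> simp [hτ]
  have hfeas : Feasible τ I s := by
    refine ⟨fun i => ?_, ?_⟩
    · rw [hrel]
      by_cases hi : (i : ℕ) < k
      · rw [hlt i hi, if_pos hi]
        have h2 : 0 ≤ (i : ℝ) * (P + τ) := by positivity
        constructor <;> nlinarith
      · rw [hge i hi, if_neg hi]
        have h1 : (k : ℝ) ≤ (i : ℕ) := by exact_mod_cast not_lt.1 hi
        have h2 : 0 ≤ ((i : ℝ) - k) * P := mul_nonneg (by linarith) hP0
        constructor <;> linarith
    -- The disjunction says that `i` precedes `j`: burst before initial jobs, and by index within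
    -- each group.
    · have key : ∀ i j : Fin I.n, ((k ≤ (i : ℕ) ∧ (j : ℕ) < k) ∨
          ((i : ℕ) < j ∧ ((j : ℕ) < k ∨ k ≤ (i : ℕ)))) →
          s i + (I.job i).work + (if (I.job i).queue = (I.job j).queue then 0 else τ) ≤ s j := by
        intro i j hij
        have hwi := hw i
        have hsij := hset i j
        rcases hij with ⟨hi, hj⟩ | ⟨hij, hj | hi⟩
        · rw [hge i (by omega), hlt j hj]
          have h1 : ((i : ℕ) : ℝ) + 1 ≤ k + M := by exact_mod_cast i.isLt
          have h2 : 0 ≤ (j : ℝ) * (P + τ) := by positivity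
          nlinarith
        · rw [hlt i (by omega), hlt j hj]
          have h1 : ((i : ℕ) : ℝ) + 1 ≤ (j : ℕ) := by exact_mod_cast hij
          nlinarith
        · rw [hge i (by omega), hge j (by omega)]
          have h1 : ((i : ℕ) : ℝ) + 1 ≤ (j : ℕ) := by exact_mod_cast hij
          have h2 : (I.job i).queue = (I.job j).queue := by
            rw [hqueue, hqueue, dif_neg (by omega), dif_neg (by omega)]
          rw [if_pos h2]
          nlinarith
      intro i j hij
      have hne : (i : ℕ) ≠ j := fun h => hij (Fin.ext h)
      by_cases h : (k ≤ (i : ℕ) ∧ (j : ℕ) < k) ∨ ((i : ℕ) < j ∧ ((j : ℕ) < k ∨ k ≤ (i : ℕ)))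
      · exact Or.inl (key i j h)
      · right
        have := key j i (by omega)
        simpa only [eq_comm] using this
  refine (optCost_le hfeas).trans ?_
  rw [totalCompletion_burst]
  have h1 : ∑ i : Fin k, (s (Fin.castAdd M i) + (I.job (Fin.castAdd M i)).work) ≤
      ∑ _i : Fin k, (4 + 2 * (k : ℝ)) * τ := by
    refine Finset.sum_le_sum fun i _ => ?_
    have hwi := hw (Fin.castAdd M i)
    have hi : ((i : ℕ) : ℝ) + 1 ≤ k := by exact_mod_cast i.isLt
    rw [hlt _ (by simp)]
    simp only [Fin.val_castAdd]
    have h2 : (((i : ℕ) : ℝ) + 1) * (P + τ) ≤ k * (2 * τ) :=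
      mul_le_mul hi (by linarith) (by linarith) (by linarith)
    nlinarith
  have h2 : ∑ i : Fin M, (s (Fin.natAdd k i) + (I.job (Fin.natAdd k i)).work) ≤
      ∑ _i : Fin M, (τ + 2 * δ) := by
    refine Finset.sum_le_sum fun i _ => ?_
    have hwi := hw (Fin.natAdd k i)
    have hi : ((i : ℕ) : ℝ) + 1 ≤ M := by exact_mod_cast i.isLt
    rw [hge _ (by simp)]
    simp only [Fin.val_natAdd]
    push_cast
    nlinarith
  simp only [Finset.sum_const, Finset.card_univ, Fintype.card_fin, nsmul_eq_mul] at h1 h2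
  nlinarith

end Burst

/-! ### Cost of gated policies on the burst -/

namespace Run

variable {I : JobInstance k} {R : Run I} {τ pmax : ℝ}

/-- The first `k` visits go through all queues and each needs a setup; the burst missed the first
gate, so its queue must be set up once more. -/
lemma Gated.gate_ge (hg : R.Gated τ pmax) (hτ : 0 ≤ τ) (hk : 2 ≤ k) {b : Fin I.n}
    (hqb : ((I.job b).queue : ℕ) = 0) (h1 : τ < (I.job b).release)
    (h2 : (I.job b).release ≤ 2 * τ) (hs0 : R.setup 0 = 0)
    (hfree : ∀ j < R.visit b, R.depart j ≤ R.setup (j + 1))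
    (hq : ∀ j ≤ R.visit b, j < k → (R.queue j : ℕ) = j) :
    ((k : ℝ) + 1) * τ ≤ R.gate τ (R.visit b) := by
  have hk2 : (2 : ℝ) ≤ k := by exact_mod_cast hk
  have step : ∀ j < R.visit b, R.gate τ j + R.setupTime τ (j + 1) ≤ R.gate τ (j + 1) := by
    intro j hj
    have hjc : (j : ℕ∞) < R.count := lt_trans (by exact_mod_cast hj) (hg.visit_lt b)
    have h3 := hg.gate_le_depart hjc
    have h4 := hfree j hj
    have h5 : R.gate τ (j + 1) = R.setup (j + 1) + R.setupTime τ (j + 1) := rfl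
    linarith
  have hswitch : ∀ j, R.queue (j + 1) ≠ R.queue j → R.setupTime τ (j + 1) = τ := by
    intro j hj
    simp only [setupTime, if_neg hj]
  have hgate0 : R.gate τ 0 = τ := by simp [gate, setupTime, hs0]
  have first : ∀ j ≤ R.visit b, j < k → ((j : ℝ) + 1) * τ ≤ R.gate τ j := by
    intro j
    induction j with
    | zero => intro _ _; simp [hgate0]
    | succ j ih =>
      intro hj hjk
      have h3 := ih (by omega) (by omega)
      have h4 := step j (by omega)
      rw [hswitch j (fun h => by
        have e1 := hq (j + 1) hj hjk
        have e2 := hq j (by omega) (by omega)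
        rw [h] at e1
        omega)] at h4
      push_cast
      linarith
  have hqv : R.queue (R.visit b) = (I.job b).queue := (hg.2.1 b).1.2.1
  have hv : k ≤ R.visit b := by
    by_contra! hv
    have h3 := hq _ le_rfl hv
    rw [hqv, hqb] at h3
    have h4 := (hg.2.1 b).1.2.2
    rw [← h3, hgate0] at h4
    linarith
  have mono : ∀ j, k - 1 ≤ j → j ≤ R.visit b → (k : ℝ) * τ ≤ R.gate τ j := by
    intro j hj
    induction j, hj using Nat.le_induction with
    | base =>
      intro hj
      have h3 := first (k - 1) hj (by omega)
      have h4 : ((k - 1 : ℕ) : ℝ) + 1 = k := by exact_mod_cast (by omega : k - 1 + 1 = k)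
      rwa [h4] at h3
    | succ j hj ih =>
      intro hjv
      have h3 := ih (by omega)
      have h4 := step j (by omega)
      have h5 := setupTime_nonneg (R := R) hτ (j + 1)
      linarith
  obtain ⟨u, hu⟩ : ∃ u, R.visit b = u + 1 := ⟨R.visit b - 1, by omega⟩
  have h3 := mono u (by omega) (by omega)
  have h4 := step u (by omega)
  -- Without a switch, visit `u` to the same queue would have its gate before the release of `b`,
  -- hence before `2 * τ ≤ k * τ`.
  rw [hswitch u (fun h => by
    have h5 := hg.gate_lt_release (a := b) (j := u) (by omega) (by rw [← h, ← hu, hqv])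
    nlinarith)] at h4
  rw [hu]
  linarith

lemma CyclicNoSkip.gate_ge (h : R.CyclicNoSkip) (hg : R.Gated τ pmax) (hτ : 0 ≤ τ) (hk : 2 ≤ k)
    {b : Fin I.n} (hqb : ((I.job b).queue : ℕ) = 0) (h1 : τ < (I.job b).release)
    (h2 : (I.job b).release ≤ 2 * τ) : ((k : ℝ) + 1) * τ ≤ R.gate τ (R.visit b) :=
  hg.gate_ge hτ hk hqb h1 h2 (h.2 0).2 (fun j _ => (h.2 (j + 1)).2.ge) fun j _ hj => by
    rw [(h.2 j).1, Nat.mod_eq_of_lt hj]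

/-- With a job in every queue at time `0`, no queue is empty before its first visit, so skipping
changes nothing in the first round. -/
lemma CyclicSkip.gate_ge (h : R.CyclicSkip) (hg : R.Gated τ pmax) (hτ : 0 ≤ τ) (hk : 2 ≤ k)
    (hI : ∀ q, ∃ i, (I.job i).queue = q ∧ (I.job i).release = 0)
    {b : Fin I.n} (hqb : ((I.job b).queue : ℕ) = 0) (h1 : τ < (I.job b).release)
    (h2 : (I.job b).release ≤ 2 * τ) : ((k : ℝ) + 1) * τ ≤ R.gate τ (R.visit b) := by
  have hcount : ∀ j ≤ R.visit b, (j : ℕ∞) < R.count := fun j hj =>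
    lt_of_le_of_lt (by exact_mod_cast hj) (hg.visit_lt b)
  have hstep : ∀ j < R.visit b, R.SkipStep (j + 1) := fun j hj =>
    (h (j + 1) (hcount _ hj)).resolve_right (by omega)
  have hfree : ∀ j < R.visit b, R.depart j ≤ R.setup (j + 1) := fun j hj => (hstep j hj).1.1.1
  have hzero : R.setup 0 = 0 ∧ (R.queue 0 : ℕ) = 0 := by
    rcases h 0 (hcount 0 (Nat.zero_le _)) with ⟨hl, -, hmin⟩ | ⟨-, h3, h4⟩
    · obtain ⟨i, hiq, hir⟩ := hI ⟨0, by omega⟩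
      have hwait : R.Waiting 0 0 ⟨0, by omega⟩ := ⟨i, hiq, hir.le, Nat.zero_le _⟩
      have h3 : R.setup 0 = 0 := le_antisymm (hl.2 ⟨le_rfl, _, hwait⟩) hl.1.1
      refine ⟨h3, ?_⟩
      have h4 := hmin h3 ⟨0, by omega⟩ (by rwa [h3])
      have h5 := (R.queue 0).isLt
      simp only [lastQueue] at h4
      rw [ahead_eq (by omega), ahead_eq (by omega)] at h4
      split_ifs at h4 <;> simp only at * <;> omega
    · exact ⟨h4, h3⟩
  have hnonneg : ∀ j ≤ R.visit b, 0 ≤ R.setup j := by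
    intro j
    induction j with
    | zero => intro _; exact hzero.1.ge
    | succ j ih =>
      intro hj
      have h3 := ih (by omega)
      have h4 := hfree j (by omega)
      have h5 := hg.gate_le_depart (hcount j (by omega))
      have h6 := setupTime_nonneg (R := R) hτ j
      have h7 : R.gate τ j = R.setup j + R.setupTime τ j := rfl
      linarith
  have hq : ∀ j ≤ R.visit b, j < k → (R.queue j : ℕ) = j := by
    intro j
    induction j using Nat.strong_induction_on with
    | _ j ih =>
      intro hj hjk
      cases j with
      | zero => exact hzero.2
      | succ j =>
        obtain ⟨i, hiq, hir⟩ := hI ⟨j + 1, hjk⟩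
        have hvi : j + 1 ≤ R.visit i := by
          by_contra! hlt
          have h3 := ih _ hlt (by omega) (by omega)
          rw [(hg.2.1 i).1.2.1, hiq] at h3
          simp only at h3
          omega
        obtain ⟨hl, -, hmin⟩ := hstep j (by omega)
        have hdep : 0 ≤ R.depart j := by
          have h5 := hg.gate_le_depart (hcount j (by omega))
          have h6 := setupTime_nonneg (R := R) hτ j
          have h7 : R.gate τ j = R.setup j + R.setupTime τ j := rfl
          have h8 := hnonneg j (by omega)
          linarith
        have h3 : R.setup (j + 1) = R.freeTime (j + 1) :=
          le_antisymm (hl.2 ⟨le_rfl, _, i, rfl, hir.le.trans hdep, hvi⟩) hl.1.1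
        have h4 := hmin h3 ⟨j + 1, hjk⟩ ⟨i, hiq, hir.le.trans (hnonneg _ hj), hvi⟩
        have h5 := (R.queue (j + 1)).isLt
        simp only [lastQueue, ih j (by omega) (by omega) (by omega)] at h4
        rw [ahead_eq (by omega), ahead_eq (by omega)] at h4
        split_ifs at h4 <;> simp only at * <;> omega
  exact hg.gate_ge hτ hk hqb h1 h2 hzero.1 hfree hq

lemma Gated.gate_le_start (hg : R.Gated τ pmax) (i : Fin I.n) :
    R.gate τ (R.visit i) ≤ R.start τ i ∧ 0 ≤ R.start τ i := by
  have h0 : 0 ≤ ∑ i' ∈ (R.batch (R.visit i)).filter (fun i' => R.pos i' < R.pos i),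
      (I.job i').work := Finset.sum_nonneg fun i _ => I.work_nonneg i
  have h1 := (hg.2.1 i).1.2.2
  have h2 := I.release_nonneg i
  have h3 : R.gate τ (R.visit i) ≤ R.start τ i := by unfold start; linarith
  exact ⟨h3, by linarith⟩

lemma Gated.le_cost_burst {γ p : ℝ} {M : ℕ} {hk0 : 0 < k} {hτ : 0 ≤ τ} {hγ : 0 ≤ γ} {hp : 0 ≤ p}
    {R : Run (burst k τ γ p M hk0 hτ hγ hp)} (hg : R.Gated τ pmax) (hk : 2 ≤ k) (hτ0 : 0 < τ)
    (hM : 0 < M) (h : R.CyclicNoSkip ∨ R.CyclicSkip) :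
    M * (((k : ℝ) + 1) * τ) ≤ R.cost τ := by
  refine le_trans ?_ (totalCompletion_burst (hk := hk0) (hτ := hτ) (hγ := hγ) (hp := hp)
    (R.start τ)).ge
  have hM1 : (1 : ℝ) ≤ M := by exact_mod_cast hM
  have hδ : 0 < τ / M := by positivity
  have hδτ : τ / M ≤ τ := div_le_self hτ hM1
  have h1 : 0 ≤ ∑ i : Fin k, (R.start τ (Fin.castAdd M i) +
      ((burst k τ γ p M hk0 hτ hγ hp).job (Fin.castAdd M i)).work) :=
    Finset.sum_nonneg fun i _ => add_nonneg (hg.gate_le_start _).2 (JobInstance.work_nonneg _ _)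
  have h2 : ∑ _i : Fin M, ((k : ℝ) + 1) * τ ≤ ∑ i : Fin M, (R.start τ (Fin.natAdd k i) +
      ((burst k τ γ p M hk0 hτ hγ hp).job (Fin.natAdd k i)).work) := by
    refine Finset.sum_le_sum fun i _ => ?_
    have hw := (burst k τ γ p M hk0 hτ hγ hp).work_nonneg (Fin.natAdd k i)
    have hr : ((burst k τ γ p M hk0 hτ hγ hp).job (Fin.natAdd k i)).release = τ + τ / M := by
      simp [burst]
    have hq : (((burst k τ γ p M hk0 hτ hγ hp).job (Fin.natAdd k i)).queue : ℕ) = 0 := by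
      simp [burst]
    have hgate : ((k : ℝ) + 1) * τ ≤ R.gate τ (R.visit (Fin.natAdd k i)) := by
      rcases h with h | h
      · exact h.gate_ge hg hτ hk hq (by linarith) (by linarith)
      · refine h.gate_ge hg hτ hk (fun q => ⟨Fin.castAdd M q, ?_, ?_⟩) hq (by linarith)
          (by linarith) <;> simp [burst]
    have := (hg.gate_le_start (Fin.natAdd k i)).1
    linarith
  simp only [Finset.sum_const, Finset.card_univ, Fintype.card_fin, nsmul_eq_mul] at h2
  linarith

end Run

end Polling

/-! ### Both bounds combined -/

theorem theorem3 (k : ℕ) (hk : 2 ≤ k) (τ γ : ℝ) (hτ : 0 ≤ τ) (hγ : 1 ≤ γ)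
    (e : Polling.Policy k)
    (he : e ∈ Polling.gatedNoSkip k τ γ ∪ Polling.gatedSkip k τ γ) :
    e.HasCompetitiveRatio τ γ (max (3 / 2 * γ) ((k : ℝ) + 1)) ∧
    (0 < τ → 3 / 2 * γ ≤ (k : ℝ) + 1 → ∀ ε : ℝ, 0 < ε →
      ∃ (pmin : ℝ) (I : Polling.JobInstance k), 0 < pmin ∧ I.WorkRange pmin (γ * pmin) ∧
        0 < Polling.optCost τ I ∧
        max (3 / 2 * γ) ((k : ℝ) + 1) - ε <
          (e pmin (γ * pmin) I).cost τ / Polling.optCost τ I) := by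
  have hrun : ∀ (pmin pmax : ℝ) (I : Polling.JobInstance k), Polling.Admissible γ pmin pmax I →
      (e pmin pmax I).Gated τ pmax ∧
        ((e pmin pmax I).CyclicNoSkip ∨ (e pmin pmax I).CyclicSkip) := by
    intro pmin pmax I hI
    rcases he with he | he
    · exact ⟨(he.2 _ _ _ hI).1, Or.inl (he.2 _ _ _ hI).2⟩
    · exact ⟨(he.2 _ _ _ hI).1, Or.inr (he.2 _ _ _ hI).2⟩
  refine ⟨fun pmin pmax I hI => ?_, fun hτ0 hle ε hε => ?_⟩
  · obtain ⟨hg, hc⟩ := hrun pmin pmax I hI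
    refine hg.cost_le hτ hk hγ hI fun a => ?_
    rcases hc with hc | hc
    · exact hc.heads a
    · exact hc.heads hg a
  · rw [max_eq_right hle]
    -- The optimum is at most `τ * (M + D)` with `D` independent of `M`; the choice `ε * M > (k + 1)
    -- * D` makes `(k + 1) * M` exceed `(k + 1 - ε) * (M + D)`.
    set D : ℝ := 2 + k * (4 + 2 * k) with hD
    obtain ⟨M, hM⟩ := exists_nat_gt (((k : ℝ) + 1) * D / ε)
    have hM0 : (0 : ℝ) < M := lt_of_le_of_lt (by positivity) hM
    rw [div_lt_iff₀ hε] at hM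
    have hMpos : 0 < M := by exact_mod_cast hM0
    have hγ0 : 0 < γ := by linarith
    -- With this `p`, `M` jobs of the largest size take only `τ / M` in total.
    set p : ℝ := τ / M ^ 2 / γ with hp
    have hp0 : 0 < p := by positivity
    have hpM : γ * p = τ / M ^ 2 := by rw [hp]; field_simp
    set I := Polling.burst k τ γ p M (by omega) hτ hγ0.le hp0.le
    have hpp : p ≤ γ * p := le_mul_of_one_le_left hp0.le hγ
    obtain ⟨hg, hc⟩ := hrun p (γ * p) I ⟨hp0.le, hpp, le_rfl, Polling.burst_work_le hγ⟩
    have hcost := hg.le_cost_burst hk hτ0 hMpos hc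
    have hopt : Polling.optCost τ I ≤ τ * (M + 2 + k * (4 + 2 * k)) :=
      Polling.optCost_burst_le hγ hMpos hpM
    have hpos : 0 < Polling.optCost τ I := by
      refine lt_of_lt_of_le ?_ (Polling.le_optCost hτ fun s hs =>
        Polling.card_mul_le_totalCompletion hs)
      have : 0 < I.n := by simp only [I, Polling.burst]; omega
      positivity
    refine ⟨p, I, hp0, Polling.burst_workRange hk hγ, hpos, ?_⟩
    rw [lt_div_iff₀ hpos]
    have hD0 : 0 < D := by positivity
    by_cases hneg : (k : ℝ) + 1 - ε ≤ 0
    · have h1 := mul_nonpos_of_nonpos_of_nonneg hneg hpos.le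
      have h2 : 0 < M * (((k : ℝ) + 1) * τ) := by positivity
      linarith
    · have h1 := mul_le_mul_of_nonneg_left hopt (not_le.1 hneg).le
      have h2 : ((k : ℝ) + 1 - ε) * (M + D) < M * ((k : ℝ) + 1) := by
        have : 0 < ε * D := by positivity
        nlinarith
      have h3 := mul_lt_mul_of_pos_left h2 hτ0
      rw [hD] at h3
      nlinarith
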